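/- Call $G\colon\mathbb{R}\to\mathbb{R}$ *$l$-finite* ($l\in\mathbb{N}$) if $G\in C^l(\mathbb{R})$ and $0<\int_{\mathbb{R}}|G^{(l)}(t)|\,dt<\infty$. A *feedforward neural network with activation $G$* on $\mathbb{R}^n$ with values in a finite-dimensional real vector space $V$ (scalars or matrices) is a function of the form $x\mapsto\sum_{j=1}^N G(w_j^\top x+b_j)\,c_j$ with $N\in\mathbb{N}$, $w_j\in\mathbb{R}^n$, $b_j\in\mathbb{R}$, $c_j\in V$ (one hidden layer, linear output). Let $\|\cdot\|$ denote the Euclidean norm of vectors and the induced operator norm of matrices, and let suprema of nonnegative quantities over the empty set be $0$. Let $\mathcal{K}\subset\mathbb{R}^n$ be compact. Let $J\colon\mathcal{K}\to\mathbb{R}^{n\times n}$, $\sigma\colon\mathcal{K}\to\mathbb{R}^{n\times d}$ and $D\colon\mathcal{K}\to\mathbb{R}^{r\times n}$ be continuous, with $J(x)=-J(x)^\top$ for all $x\in\mathcal{K}$, and put $R(x)=D(x)^\top D(x)$ for $x\in\mathcal{K}$. Let $H\in C^2(\mathbb{R}^n)$, and let $G$ be $l$-finite for some $l\in\mathbb{N}$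 with $l>2$. Then for every $\varepsilon>0$ there exist feedforward neural networks with activation $G$ $$\hat A\colon\mathbb{R}^n\to\mathbb{R}^{n\times n},\quad \hat D\colon\mathbb{R}^n\to\mathbb{R}^{r\times n},\quad \hat\sigma\colon\mathbb{R}^n\to\mathbb{R}^{n\times d},\quad \hat H\colon\mathbb{R}^n\to\mathbb{R}$$ such that, with $\hat J(x)=\hat A(x)-\hat A(x)^\top$ and $\hat R(x)=\hat D(x)^\top\hat D(x)$: 1. $\hat J(x)=-\hat J(x)^\top$ and $\hat R(x)$ is symmetric positive semidefinite for all $x\in\mathbb{R}^n$; 2. $$\sup_{x\in\mathcal{K}}\Big(\|\hat J(x)-J(x)\|+\|\hat R(x)-R(x)\|+\|\hat\sigma(x)-\sigma(x)\|\Big)+\|\hat H-H\|_{C^2(\mathcal{K})}\le\varepsilon,$$ where $$\|\hat H-H\|_{C^2(\mathcal{K})}=\sup_{x\in\mathcal{K}}|\hat H(x)-H(x)|+\sup_{x\in\mathcal{K}}\|\nabla\hat H(x)-\nabla H(x)\|+\sup_{x\in\mathcal{K}}\|\nabla^2\hat H(x)-\nabla^2H(x)\|.$$ -/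

import Mathlib

open MeasureTheory
open scoped ENNReal Matrix Gradient Matrix.Norms.L2Operator

noncomputable section

/-- `G` is `l`-finite: `G ∈ C^l(ℝ)` and `0 < ∫ |D^l G| dλ < ∞`, with `λ` Lebesgue measure. -/
def LFinite (l : ℕ) (G : ℝ → ℝ) : Prop :=
  ContDiff ℝ l G ∧ 0 < ∫⁻ t, ‖iteratedDeriv l G t‖ₑ ∧ ∫⁻ t, ‖iteratedDeriv l G t‖ₑ < ∞

/-- `f` is (the function computed by) a feedforward neural network on `ℝⁿ` with activation `G`,
one hidden layer of `N` units, and a linear output layer, with outputs in a real vector space `V`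
(here scalars or matrices): `f x = ∑ j, G (⟨w j, x⟩ + b j) • c j`. -/
def IsNeuralNetwork {n : ℕ} {V : Type*} [AddCommGroup V] [Module ℝ V] (G : ℝ → ℝ)
    (f : EuclideanSpace ℝ (Fin n) → V) : Prop :=
  ∃ (N : ℕ) (w : Fin N → EuclideanSpace ℝ (Fin n)) (b : Fin N → ℝ) (c : Fin N → V),
    ∀ x, f x = ∑ j, G (inner ℝ (w j) x + b j) • c j

/-- The Hessian of `f` at `x`, as the linear operator `D(∇f)(x)` on `ℝⁿ`; its norm is the
operator norm induced by the Euclidean norm. -/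
def hessian {n : ℕ} (f : EuclideanSpace ℝ (Fin n) → ℝ) (x : EuclideanSpace ℝ (Fin n)) :
    EuclideanSpace ℝ (Fin n) →L[ℝ] EuclideanSpace ℝ (Fin n) :=
  fderiv ℝ (fun y => ∇ f y) x

/-- The `C²(K)`-distance of `f` and `g`. The suprema are taken in `[0, ∞]`. -/
def c2Dist {n : ℕ} (K : Set (EuclideanSpace ℝ (Fin n)))
    (f g : EuclideanSpace ℝ (Fin n) → ℝ) : ℝ≥0∞ :=
  (⨆ x ∈ K, ‖f x - g x‖ₑ) + (⨆ x ∈ K, ‖∇ f x - ∇ g x‖ₑ)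
    + (⨆ x ∈ K, ‖hessian f x - hessian g x‖ₑ)

end

/-! ### Two-jets, plane waves and their Fourier transforms. -/

section TwoJets

set_option maxSynthPendingDepth 3

open scoped FourierTransform

variable {E P : Type*} [NormedAddCommGroup E] [InnerProductSpace ℝ E]
  [NormedAddCommGroup P] [InnerProductSpace ℝ P]

/-! The analytic core is the density of ridge functions `G (⟨w, x⟩ + b)` in `C²(K)`. Embed `C²`
functions in `C(K, JetSpace E)` by their two-jets. By Hahn–Banach it suffices that a functional `L`
killing all ridge jets kills the jet of every `C²` function. Since `G` itself need not be
integrable, work with `G⁽ˡ⁾ ∈ L¹`. For a test function `φ`, integration by parts turns `G⁽ˡ⁾ * jet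
φ` into `φ⁽ˡ⁾ * jet G`, which `L` kills. Taking Fourier transforms, `𝓕 G⁽ˡ⁾ (s) · 𝓕 φ (s) · L(wave
of frequency s) = 0` (`functional_wave_eq_zero_of_ridge`). As `G⁽ˡ⁾ ≠ 0`, some `s ≠ 0` has `𝓕 G⁽ˡ⁾
(s) ≠ 0`, and rescaling `w` reaches every plane wave. If `L` kills all plane waves, then for
compactly supported `f` the function `p ↦ L(jet of f(· + p))` has zero Fourier transform, so it
vanishes (`functional_eq_zero_of_waves`). A cutoff removes the support condition. Uniform
approximation of continuous matrix fields follows by extension, smoothing and coordinates. The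
structure comes for free: approximate `J / 2` and skew-symmetrize, and approximate `D` and form its
Gram matrix. -/

/-- Values of two-jets of complex-valued functions on `E`. -/
abbrev JetSpace (E : Type*) [NormedAddCommGroup E] [InnerProductSpace ℝ E] : Type _ :=
  ℂ × (E →L[ℝ] ℂ) × (E →L[ℝ] E →L[ℝ] ℂ)

/-- The value, first and second derivative of `f` at `x`. -/
noncomputable def twoJet (f : E → ℂ) (x : E) : JetSpace E :=
  (f x, fderiv ℝ f x, fderiv ℝ (fderiv ℝ f) x)

lemma continuous_twoJet {f : E → ℂ} (hf : ContDiff ℝ 2 f) : Continuous (twoJet f) := by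
  have h1 : ContDiff ℝ 1 (fderiv ℝ f) := hf.fderiv_right (by norm_num)
  exact hf.continuous.prodMk (h1.continuous.prodMk (h1.continuous_fderiv one_ne_zero))

lemma twoJet_congr {f g : E → ℂ} {x : E} (h : f =ᶠ[nhds x] g) : twoJet f x = twoJet g x := by
  simp only [twoJet, h.eq_of_nhds, h.fderiv_eq, h.fderiv.fderiv_eq]

lemma twoJet_zero (x : E) : twoJet (0 : E → ℂ) x = 0 := by
  have h : fderiv ℝ (0 : E → ℂ) = 0 := by ext; simp
  have h' : fderiv ℝ (0 : E → E →L[ℝ] ℂ) x = 0 := by simp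
  simp only [twoJet, h, h', Pi.zero_apply, Prod.mk_zero_zero]

/-- The action of a linear map on two-jets by pullback. -/
noncomputable def jetPullback (A : E →L[ℝ] P) : JetSpace P →L[ℝ] JetSpace E :=
  (ContinuousLinearMap.fst ℝ ℂ _).prod
    (((ContinuousLinearMap.compL ℝ E P ℂ).flip A ∘L
        ContinuousLinearMap.fst ℝ _ _ ∘L ContinuousLinearMap.snd ℝ ℂ _).prod
      (ContinuousLinearMap.compL ℝ E (P →L[ℝ] ℂ) (E →L[ℝ] ℂ)
          ((ContinuousLinearMap.compL ℝ E P ℂ).flip A) ∘L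
        (ContinuousLinearMap.compL ℝ E P (P →L[ℝ] ℂ)).flip A ∘L
        ContinuousLinearMap.snd ℝ _ _ ∘L ContinuousLinearMap.snd ℝ ℂ _))

lemma jetPullback_apply (A : E →L[ℝ] P) (u : JetSpace P) :
    jetPullback A u = (u.1, u.2.1.comp A,
      ((ContinuousLinearMap.compL ℝ E P ℂ).flip A).comp (u.2.2.comp A)) := rfl

lemma jetPullback_smul (A : E →L[ℝ] P) (c : ℂ) (u : JetSpace P) :
    jetPullback A (c • u) = c • jetPullback A u := by
  simp only [jetPullback_apply]
  refine Prod.ext rfl (Prod.ext ?_ ?_)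
  · ext; simp
  · ext; simp

lemma twoJet_comp_affine (A : E →L[ℝ] P) (p : P) {f : P → ℂ} (hf : ContDiff ℝ 2 f) (x : E) :
    twoJet (fun y => f (A y + p)) x = jetPullback A (twoJet f (A x + p)) := by
  have hd : ∀ y, HasFDerivAt (fun y => A y + p) A y := fun y => A.hasFDerivAt.add_const p
  have h1 : fderiv ℝ (fun y => f (A y + p)) =
      fun y => (ContinuousLinearMap.compL ℝ E P ℂ).flip A (fderiv ℝ f (A y + p)) := by
    funext y
    exact ((hf.differentiable two_ne_zero _).hasFDerivAt.comp y (hd y)).fderiv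
  have hf1 : ContDiff ℝ 1 (fderiv ℝ f) := hf.fderiv_right (by norm_num)
  refine Prod.ext rfl (Prod.ext ?_ ?_)
  · exact congrFun h1 x
  · change fderiv ℝ (fderiv ℝ (fun y => f (A y + p))) x = _
    rw [h1]
    exact (((ContinuousLinearMap.compL ℝ E P ℂ).flip A).hasFDerivAt.comp x
      ((hf1.differentiable one_ne_zero _).hasFDerivAt.comp x (hd x))).fderiv

/-- The family of two-jets on `K` of the functions `y ↦ f (A y + p)`, parametrized by `p`. -/
noncomputable def jetCurve (K : Set E) [CompactSpace K] (A : E →L[ℝ] P) (f : P → ℂ)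
    (hf : ContDiff ℝ 2 f) : C(P, C(K, JetSpace E)) :=
  ContinuousMap.curry ⟨fun z : P × K => jetPullback A (twoJet f (A z.2 + z.1)), by
    have := continuous_twoJet hf
    fun_prop⟩

lemma jetCurve_apply (K : Set E) [CompactSpace K] (A : E →L[ℝ] P) {f : P → ℂ}
    (hf : ContDiff ℝ 2 f) (p : P) (x : K) :
    jetCurve K A f hf p x = jetPullback A (twoJet f (A x + p)) := rfl

lemma hasCompactSupport_twoJet {f : P → ℂ} (hc : HasCompactSupport f) :
    HasCompactSupport (twoJet f) := by
  refine HasCompactSupport.intro hc fun q hq => ?_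
  rw [twoJet_congr (g := 0) (notMem_tsupport_iff_eventuallyEq.mp hq), twoJet_zero]

/-- If the jet is nonzero at some `x ∈ K`, then `A x + p` lies in the support of `twoJet f`, so `p`
lies in that support minus `A(K)`, a compact set. -/
lemma hasCompactSupport_jetCurve (K : Set E) [CompactSpace K] (A : E →L[ℝ] P) {f : P → ℂ}
    (hf : ContDiff ℝ 2 f) (hc : HasCompactSupport f) :
    HasCompactSupport (jetCurve K A f hf) := by
  have hK : IsCompact K := isCompact_iff_compactSpace.mpr inferInstance
  have hS : IsCompact (tsupport (twoJet f)) := hasCompactSupport_twoJet hc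
  refine HasCompactSupport.intro
    ((hS.prod (hK.image A.continuous)).image (f := fun z => z.1 - z.2) (by fun_prop))
    fun p hp => ?_
  ext1 x
  rw [jetCurve_apply, ContinuousMap.zero_apply]
  by_contra h
  refine hp ⟨(A x + p, A x), ⟨subset_tsupport _ fun h0 => h ?_,
    Set.mem_image_of_mem A x.2⟩, by simp⟩
  rw [h0, map_zero]

/-- The character `q ↦ exp (2πi⟨q, s⟩)`. -/
noncomputable def waveFun (s : P) (q : P) : ℂ := (Real.fourierChar (inner ℝ q s) : ℂ)

lemma contDiff_waveFun (s : P) : ContDiff ℝ 2 (waveFun s) := by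
  unfold waveFun
  simp only [Real.fourierChar_apply]
  have : ContDiff ℝ 2 (fun q : P => ((2 * Real.pi * inner ℝ q s : ℝ) : ℂ)) :=
    Complex.ofRealCLM.contDiff.comp (contDiff_const.mul (contDiff_id.inner ℝ contDiff_const))
  exact (this.mul contDiff_const).cexp

lemma hasFDerivAt_waveFun (s q : P) : HasFDerivAt (waveFun s)
    (waveFun s q • ((2 * Real.pi * Complex.I) • (innerSL ℝ s).smulRight (1 : ℂ))) q := by
  have h1 : HasFDerivAt (fun q : P => ((2 * Real.pi * inner ℝ s q : ℝ) : ℂ) * Complex.I)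
      ((2 * Real.pi * Complex.I) • (innerSL ℝ s).smulRight (1 : ℂ)) q := by
    have h2 := ((2 * Real.pi * Complex.I) • (innerSL ℝ s).smulRight (1 : ℂ)).hasFDerivAt (x := q)
    refine h2.congr_of_eventuallyEq (Filter.Eventually.of_forall fun y => ?_)
    simp
    ring
  have h3 := h1.cexp
  unfold waveFun
  simp only [Real.fourierChar_apply, real_inner_comm s]
  exact h3

/-- Translating a character only multiplies it by a scalar, so its jet at `q` is a multiple of one
fixed jet. -/
lemma twoJet_waveFun (s q : P) : twoJet (waveFun s) q = waveFun s q •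
    ((1, (2 * Real.pi * Complex.I) • (innerSL ℝ s).smulRight (1 : ℂ),
      ((2 * Real.pi * Complex.I) • (innerSL ℝ s).smulRight
        ((2 * Real.pi * Complex.I) • (innerSL ℝ s).smulRight (1 : ℂ)))) : JetSpace P) := by
  have h1 : fderiv ℝ (waveFun s) = fun q =>
      waveFun s q • ((2 * Real.pi * Complex.I) • (innerSL ℝ s).smulRight (1 : ℂ)) := by
    funext q; exact (hasFDerivAt_waveFun s q).fderiv
  refine Prod.ext (by simp [twoJet]) (Prod.ext ?_ ?_)
  · simp [twoJet, h1]
  · simp only [twoJet, h1]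
    refine ((hasFDerivAt_waveFun s q).smul_const _).fderiv.trans ?_
    ext v w
    simp
    ring

variable [FiniteDimensional ℝ P] [MeasurableSpace P] [BorelSpace P]

/-- Differentiation becomes multiplication by `2πi⟨·, s⟩`, and these factors are exactly the jet of
the wave at the origin. -/
lemma fourier_twoJet {f : P → ℂ} (hf : ContDiff ℝ 2 f) (hc : HasCompactSupport f) (s : P) :
    𝓕 (twoJet f) s = 𝓕 f s • twoJet (waveFun s) 0 := by
  have hf1 : ContDiff ℝ 1 (fderiv ℝ f) := hf.fderiv_right (by norm_num)
  have i0 : Integrable f := hf.continuous.integrable_of_hasCompactSupport hc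
  have i1 : Integrable (fderiv ℝ f) :=
    hf1.continuous.integrable_of_hasCompactSupport (hc.fderiv ℝ)
  have i2 : Integrable (fderiv ℝ (fderiv ℝ f)) :=
    (hf1.continuous_fderiv one_ne_zero).integrable_of_hasCompactSupport ((hc.fderiv ℝ).fderiv ℝ)
  have e1 := Real.fourier_fderiv i0 (hf.differentiable two_ne_zero) i1
  have e2 := Real.fourier_fderiv i1 (hf1.differentiable one_ne_zero) i2
  have key : 𝓕 (twoJet f) s = (𝓕 f s, 𝓕 (fderiv ℝ f) s, 𝓕 (fderiv ℝ (fderiv ℝ f)) s) := by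
    have j0 := (Real.fourierIntegral_convergent_iff s).mpr i0
    have j1 := (Real.fourierIntegral_convergent_iff s).mpr i1
    have j2 := (Real.fourierIntegral_convergent_iff s).mpr i2
    simp only [Real.fourier_eq]
    rw [← integral_pair j1 j2, ← integral_pair j0 (j1.prodMk j2)]
    rfl
  rw [key, e2, e1, twoJet_waveFun]
  have hw : waveFun s 0 = 1 := by simp [waveFun]
  rw [hw, one_smul]
  refine Prod.ext (by simp) (Prod.ext ?_ ?_)
  · ext v
    simp
    erw [innerSL_apply_apply]
    ring
  · ext v w
    simp
    erw [innerSL_apply_apply, innerSL_apply_apply]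
    ring

lemma integrable_jetCurve (K : Set E) [CompactSpace K] (A : E →L[ℝ] P) {f : P → ℂ}
    (hf : ContDiff ℝ 2 f) (hc : HasCompactSupport f) :
    Integrable (jetCurve K A f hf) :=
  (jetCurve K A f hf).continuous.integrable_of_hasCompactSupport
    (hasCompactSupport_jetCurve K A hf hc)

/-- Evaluate at `x ∈ K` and substitute `q = A x + p`: the shift produces the phase `waveFun s (A
x)`, which carries the jet of the wave from `0` to `A x`. -/
lemma fourier_jetCurve (K : Set E) [CompactSpace K] (A : E →L[ℝ] P)
    {f : P → ℂ} (hf : ContDiff ℝ 2 f) (hc : HasCompactSupport f) (s : P) :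
    𝓕 (jetCurve K A f hf : P → C(K, JetSpace E)) s =
      𝓕 f s • jetCurve K A (waveFun s) (contDiff_waveFun s) 0 := by
  have hint := (Real.fourierIntegral_convergent_iff s).mpr (integrable_jetCurve K A hf hc)
  have hint' : Integrable (twoJet f) :=
    (continuous_twoJet hf).integrable_of_hasCompactSupport (hasCompactSupport_twoJet hc)
  ext1 x
  rw [Real.fourier_eq]
  have h1 := (ContinuousMap.evalCLM ℝ x).integral_comp_comm hint
  refine h1.symm.trans ?_
  have h2 : ∀ p : P, ContinuousMap.evalCLM ℝ x
      (Real.fourierChar (-inner ℝ p s) • jetCurve K A f hf p) =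
      waveFun s (A x) • jetPullback A
        (Real.fourierChar (-inner ℝ (A x + p) s) • twoJet f (A x + p)) := by
    intro p
    change (Real.fourierChar (-inner ℝ p s) : ℂ) • jetPullback A (twoJet f (A x + p)) =
      waveFun s (A x) • jetPullback A
        ((Real.fourierChar (-inner ℝ (A x + p) s) : ℂ) • twoJet f (A x + p))
    rw [jetPullback_smul, smul_smul, waveFun, ← Circle.coe_mul, ← AddChar.map_add_eq_mul,
      inner_add_left]
    congr 4
    ring
  simp_rw [h2]
  rw [integral_smul, integral_add_left_eq_self
    (fun q => jetPullback A (Real.fourierChar (-inner ℝ q s) • twoJet f q)) (A x),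
    (jetPullback A).integral_comp_comm ((Real.fourierIntegral_convergent_iff s).mpr hint'),
    ← Real.fourier_eq, fourier_twoJet hf hc, jetPullback_smul, ContinuousMap.smul_apply,
    jetCurve_apply, twoJet_waveFun s (A x + 0), twoJet_waveFun s 0, jetPullback_smul,
    jetPullback_smul, smul_comm (waveFun s (A x)), add_zero]
  simp [waveFun]

lemma fourier_functional_jetCurve (K : Set E) [CompactSpace K]
    (A : E →L[ℝ] P) {f : P → ℂ} (hf : ContDiff ℝ 2 f) (hc : HasCompactSupport f)
    (L : C(K, JetSpace E) →L[ℂ] ℂ) (s : P) :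
    𝓕 (fun p => L (jetCurve K A f hf p)) s =
      𝓕 f s * L (jetCurve K A (waveFun s) (contDiff_waveFun s) 0) := by
  have hint := (Real.fourierIntegral_convergent_iff s).mpr (integrable_jetCurve K A hf hc)
  have h := L.integral_comp_comm hint
  rw [← Real.fourier_eq, fourier_jetCurve K A hf hc, map_smul, smul_eq_mul] at h
  rw [← h, Real.fourier_eq]
  refine integral_congr_ae (Filter.Eventually.of_forall fun p => ?_)
  exact (L.map_smul ((Real.fourierChar (-inner ℝ p s) : ℂ)) _).symm

/-- Injectivity of the Fourier transform on continuous integrable functions. -/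
lemma eq_zero_of_fourier_eq_zero {f : P → ℂ} (hf : Continuous f) (hi : Integrable f)
    (h : 𝓕 f = 0) : f = 0 := by
  have h1 := hf.fourierInv_fourier_eq hi (h ▸ integrable_zero _ _ _)
  rw [← h1, h]
  funext x
  simp [Real.fourierInv_eq]

/-- A functional on jets that kills all plane waves kills the jets of compactly supported
functions. -/
lemma functional_eq_zero_of_waves {K : Set P} [CompactSpace K] (L : C(K, JetSpace P) →L[ℂ] ℂ)
    (hL : ∀ s : P, L (jetCurve K (.id ℝ P) (waveFun s) (contDiff_waveFun s) 0) = 0)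
    {f : P → ℂ} (hf : ContDiff ℝ 2 f) (hc : HasCompactSupport f) (p : P) :
    L (jetCurve K (.id ℝ P) f hf p) = 0 := by
  have h := eq_zero_of_fourier_eq_zero
    (L.continuous.comp (jetCurve K (.id ℝ P) f hf).continuous)
    (L.integrable_comp (integrable_jetCurve K (.id ℝ P) hf hc)) (by
      funext s
      refine (fourier_functional_jetCurve K (.id ℝ P) hf hc L s).trans ?_
      rw [hL, mul_zero, Pi.zero_apply])
  exact congrFun h p

end TwoJets

/-! ### Functionals that annihilate ridge functions. -/

section Ridge

set_option maxSynthPendingDepth 3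

open scoped FourierTransform ContDiff

lemma HasCompactSupport.iteratedDeriv_real {φ : ℝ → ℂ} (hc : HasCompactSupport φ) (k : ℕ) :
    HasCompactSupport (iteratedDeriv k φ) := by
  induction k with
  | zero => simpa using hc
  | succ k ih => rw [iteratedDeriv_succ]; exact ih.deriv

/-- Integrate by parts `a` times. The sign of each step cancels against the sign from
differentiating `φ (t - y)` in `y`. -/
lemma integral_iteratedDeriv_mul_iteratedDeriv_shift {l : ℕ} {u φ : ℝ → ℂ} (hu : ContDiff ℝ l u)
    (hφ : ContDiff ℝ ∞ φ) (hc : HasCompactSupport φ) (t : ℝ) (b : ℕ) :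
    ∀ a ≤ l, ∫ y, iteratedDeriv a u y * iteratedDeriv b φ (t - y) =
      ∫ y, u y * iteratedDeriv (a + b) φ (t - y) := by
  have hcs : ∀ k, HasCompactSupport (fun y => iteratedDeriv k φ (t - y)) := fun k =>
    (hc.iteratedDeriv_real k).comp_homeomorph (Homeomorph.subLeft t)
  have hcφ : ∀ k, Continuous (fun y => iteratedDeriv k φ (t - y)) := fun k =>
    (hφ.continuous_iteratedDeriv k (by exact_mod_cast le_top)).comp (by fun_prop)
  intro a
  induction a generalizing b with
  | zero => intro _; simp
  | succ a ih =>
    intro ha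
    have hint : ∀ c ≤ l, ∀ k, Integrable
        ((fun y => iteratedDeriv k φ (t - y)) * iteratedDeriv c u) := fun c hcl k =>
      ((hcφ k).mul (hu.continuous_iteratedDeriv c (by exact_mod_cast hcl))
        ).integrable_of_hasCompactSupport (hcs k).mul_right
    have hd : ∀ y, HasDerivAt (iteratedDeriv a u) (iteratedDeriv (a + 1) u y) y := fun y => by
      rw [iteratedDeriv_succ]
      exact (hu.differentiable_iteratedDeriv a (by exact_mod_cast ha) y).hasDerivAt
    have hdφ : ∀ y, HasDerivAt (fun y => iteratedDeriv b φ (t - y))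
        (-iteratedDeriv (b + 1) φ (t - y)) y := fun y => by
      rw [iteratedDeriv_succ]
      have h1 : HasDerivAt (iteratedDeriv b φ) (deriv (iteratedDeriv b φ) (t - y)) (t - y) :=
        (hφ.differentiable_iteratedDeriv b (by exact_mod_cast WithTop.coe_lt_top _) _).hasDerivAt
      exact h1.comp_const_sub t y
    have key := integral_mul_deriv_eq_deriv_mul_of_integrable (fun y _ => hdφ y) (fun y _ => hd y)
      (hint (a + 1) ha b) (by
        have := (hint a (by omega) (b + 1)).neg
        refine this.congr (Filter.Eventually.of_forall fun y => ?_)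
        simp) (hint a (by omega) b)
    have e1 : ∫ y, iteratedDeriv (a + 1) u y * iteratedDeriv b φ (t - y) =
        ∫ y, iteratedDeriv a u y * iteratedDeriv (b + 1) φ (t - y) := by
      simp_rw [mul_comm (iteratedDeriv _ u _)]
      rw [key, ← integral_neg]
      simp
    rw [e1, ih (b + 1) (by omega), show a + (b + 1) = a + 1 + b by omega]

/-- Expresses jets in one variable through scalar derivatives, so that identities between jet-valued
integrals reduce to scalar ones. -/
lemma exists_twoJet_real_eq_sum : ∃ e : ℕ → JetSpace ℝ, ∀ f : ℝ → ℂ, ContDiff ℝ 2 f → ∀ t,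
    twoJet f t = ∑ i ∈ Finset.range 3, iteratedDeriv i f t • e i := by
  let D : ℝ →L[ℝ] ℂ := (ContinuousLinearMap.id ℝ ℝ).smulRight (1 : ℂ)
  let e : ℕ → JetSpace ℝ
    | 0 => (1, 0, 0)
    | 1 => (0, D, 0)
    | _ => (0, 0, (ContinuousLinearMap.id ℝ ℝ).smulRight D)
  refine ⟨e, fun f hf t => ?_⟩
  have hf1 : ContDiff ℝ 1 (fderiv ℝ f) := hf.fderiv_right (by norm_num)
  have h2 : fderiv ℝ (fderiv ℝ f) t 1 1 = iteratedDeriv 2 f t := by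
    rw [iteratedDeriv_succ, iteratedDeriv_one]
    have : deriv f = fun t => fderiv ℝ f t 1 := by funext t; simp
    rw [this, ← fderiv_apply_one_eq_deriv, fderiv_clm_apply
      (hf1.differentiable one_ne_zero t) (by fun_prop)]
    simp
  simp only [Finset.sum_range_succ, Finset.sum_range_zero, zero_add]
  refine Prod.ext ?_ (Prod.ext ?_ ?_)
  · simp [e, twoJet]
  · ext; simp [e, twoJet, D]
  · ext
    simpa [e, twoJet, D] using h2

lemma integrable_smul_shift_of_hasCompactSupport_right {V : Type*} [NormedAddCommGroup V]
    [NormedSpace ℂ V] {g : ℝ → ℂ} {v : ℝ → V} (hg : Continuous g) (hv : Continuous v)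
    (hc : HasCompactSupport v) (b : ℝ) : Integrable fun y => g y • v (b - y) := by
  have h : HasCompactSupport fun y => v (b - y) := hc.comp_homeomorph (Homeomorph.subLeft b)
  exact (hg.smul (hv.comp (by fun_prop))).integrable_of_hasCompactSupport h.smul_left

lemma integrable_smul_shift_of_hasCompactSupport_left {V : Type*} [NormedAddCommGroup V]
    [NormedSpace ℂ V] {g : ℝ → ℂ} {v : ℝ → V} (hg : Continuous g) (hv : Continuous v)
    (hc : HasCompactSupport g) (b : ℝ) : Integrable fun y => g y • v (b - y) :=
  (hg.smul (hv.comp (by fun_prop))).integrable_of_hasCompactSupport hc.smul_right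

variable {E : Type*} [NormedAddCommGroup E] [InnerProductSpace ℝ E]

lemma integral_smul_twoJet_eq {l : ℕ} (hl : 2 ≤ l) {u φ : ℝ → ℂ} (hu : ContDiff ℝ l u)
    (hφ : ContDiff ℝ ∞ φ) (hc : HasCompactSupport φ) (t : ℝ) :
    ∫ y, iteratedDeriv l u y • twoJet φ (t - y) =
      ∫ y, iteratedDeriv l φ y • twoJet u (t - y) := by
  obtain ⟨e, he⟩ := exists_twoJet_real_eq_sum
  have hcs := hc.iteratedDeriv_real
  have hcφ : ∀ k, Continuous (iteratedDeriv k φ) := fun k =>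
    hφ.continuous_iteratedDeriv k (by exact_mod_cast le_top)
  have hcu : ∀ k ≤ l, Continuous (iteratedDeriv k u) := fun k hk =>
    hu.continuous_iteratedDeriv k (by exact_mod_cast hk)
  simp_rw [he φ (by exact_mod_cast contDiff_infty.mp hφ 2),
    he u (hu.of_le (by exact_mod_cast hl)), Finset.smul_sum, smul_smul]
  rw [integral_finsetSum, integral_finsetSum]
  · refine Finset.sum_congr rfl fun i hi => ?_
    have hil : i ≤ l := by have := Finset.mem_range.mp hi; omega
    rw [integral_smul_const, integral_smul_const]
    congr 1
    -- Move all `l` derivatives from `u` to `φ`, then return `i` of them to `u`; reflecting `y ↦ t -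
    -- y` swaps the roles.
    rw [integral_iteratedDeriv_mul_iteratedDeriv_shift hu hφ hc t i l le_rfl, add_comm l i,
      ← integral_iteratedDeriv_mul_iteratedDeriv_shift hu hφ hc t l i hil,
      ← integral_sub_left_eq_self _ volume t]
    simp [mul_comm]
  · intro i hi
    have hil : i ≤ l := by have := Finset.mem_range.mp hi; omega
    refine Integrable.smul_const (Continuous.integrable_of_hasCompactSupport
      ((hcφ l).mul ((hcu i hil).comp (by fun_prop))) (hcs l).mul_right) _
  · intro i hi
    refine Integrable.smul_const (Continuous.integrable_of_hasCompactSupport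
      ((hcu l le_rfl).mul ((hcφ i).comp (by fun_prop)))
      (((hcs i).comp_homeomorph (Homeomorph.subLeft t)).mul_left)) _


lemma integrable_iteratedDeriv_smul_jetCurve_shift (K : Set E) [CompactSpace K] (A : E →L[ℝ] ℝ)
    {l : ℕ} {u φ : ℝ → ℂ} (hu : ContDiff ℝ l u) (hφ : ContDiff ℝ 2 φ)
    (hc : HasCompactSupport φ) (b : ℝ) :
    Integrable fun y => iteratedDeriv l u y • jetCurve K A φ hφ (b - y) :=
  integrable_smul_shift_of_hasCompactSupport_right (hu.continuous_iteratedDeriv l le_rfl)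
    (jetCurve K A φ hφ).continuous (hasCompactSupport_jetCurve K A hφ hc) b

lemma integrable_iteratedDeriv_smul_jetCurve (K : Set E) [CompactSpace K] (A : E →L[ℝ] ℝ)
    {l : ℕ} {u φ : ℝ → ℂ} (hu : ContDiff ℝ 2 u) (hφ : ContDiff ℝ l φ)
    (hc : HasCompactSupport φ) (b : ℝ) :
    Integrable fun y => iteratedDeriv l φ y • jetCurve K A u hu (b - y) :=
  integrable_smul_shift_of_hasCompactSupport_left (hφ.continuous_iteratedDeriv l le_rfl)
    (jetCurve K A u hu).continuous (hc.iteratedDeriv_real l) b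

lemma integral_smul_jetCurve_eq (K : Set E) [CompactSpace K] (A : E →L[ℝ] ℝ) {l : ℕ} (hl : 2 ≤ l)
    {u φ : ℝ → ℂ} (hu : ContDiff ℝ l u) (hu2 : ContDiff ℝ 2 u) (hφ : ContDiff ℝ ∞ φ)
    (hφ2 : ContDiff ℝ 2 φ) (hc : HasCompactSupport φ) (b : ℝ) :
    ∫ y, iteratedDeriv l u y • jetCurve K A φ hφ2 (b - y) =
      ∫ y, iteratedDeriv l φ y • jetCurve K A u hu2 (b - y) := by
  have i1 := integrable_iteratedDeriv_smul_jetCurve_shift K A hu hφ2 hc b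
  have i2 := integrable_iteratedDeriv_smul_jetCurve K A hu2 (contDiff_infty.mp hφ l) hc b
  have hcu := hu.continuous_iteratedDeriv l le_rfl
  have hcφ := hφ.continuous_iteratedDeriv l (by exact_mod_cast le_top)
  ext1 x
  have e1 := (ContinuousMap.evalCLM ℝ x).integral_comp_comm i1
  have e2 := (ContinuousMap.evalCLM ℝ x).integral_comp_comm i2
  refine e1.symm.trans (Eq.trans ?_ e2)
  have hev : ∀ {f : ℝ → ℂ} (hf : ContDiff ℝ 2 f) (c : ℂ) (y : ℝ), ContinuousMap.evalCLM ℝ x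
      (c • jetCurve K A f hf (b - y)) = jetPullback A (c • twoJet f (A x + b - y)) := by
    intro f hf c y
    rw [jetPullback_smul, add_sub_assoc]
    rfl
  simp_rw [hev]
  rw [(jetPullback A).integral_comp_comm, (jetPullback A).integral_comp_comm,
    integral_smul_twoJet_eq hl hu hφ hc]
  · exact integrable_smul_shift_of_hasCompactSupport_left hcφ (continuous_twoJet hu2)
      (hc.iteratedDeriv_real l) (A x + b)
  · exact integrable_smul_shift_of_hasCompactSupport_right hcu (continuous_twoJet hφ2)
      (hasCompactSupport_twoJet hc) (A x + b)

/-- There are test functions whose Fourier transform does not vanish at `s`. -/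
lemma exists_contDiff_hasCompactSupport_fourier_ne_zero (s : ℝ) :
    ∃ φ : ℝ → ℂ, ContDiff ℝ ∞ φ ∧ HasCompactSupport φ ∧ 𝓕 φ s ≠ 0 := by
  -- Modulating a bump by the character of frequency `s` makes its transform at `s` equal to `∫ ψ >
  -- 0`.
  let ψ : ContDiffBump (0 : ℝ) := ⟨1, 2, one_pos, one_lt_two⟩
  have hw : ContDiff ℝ ∞ (fun q : ℝ => (Real.fourierChar (q * s) : ℂ)) := by
    simp only [Real.fourierChar_apply]
    exact ((Complex.ofRealCLM.contDiff.comp (by fun_prop :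
      ContDiff ℝ ∞ fun q : ℝ => 2 * Real.pi * (q * s))).mul contDiff_const).cexp
  refine ⟨fun q => (Real.fourierChar (q * s) : ℂ) * (ψ q : ℂ),
    hw.mul (Complex.ofRealCLM.contDiff.comp ψ.contDiff), ?_, ?_⟩
  · exact (ψ.hasCompactSupport.comp_left (g := fun r : ℝ => (r : ℂ)) Complex.ofReal_zero).mul_left
  · have h : 𝓕 (fun q : ℝ => (Real.fourierChar (q * s) : ℂ) * (ψ q : ℂ)) s =
        ((∫ q, ψ q : ℝ) : ℂ) := by
      rw [Real.fourier_real_eq, ← integral_complex_ofReal]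
      refine integral_congr_ae (Filter.Eventually.of_forall fun q => ?_)
      simp only [Circle.smul_def, smul_eq_mul]
      rw [← mul_assoc, ← Circle.coe_mul, ← AddChar.map_add_eq_mul]
      simp
    rw [h]
    exact_mod_cast ψ.integral_pos.ne'

/-- A functional on jets that kills all ridge functions `u (A x + b)` kills the plane waves
`exp (2πi s A x)` at each frequency `s` of `u⁽ˡ⁾`. -/
lemma functional_wave_eq_zero_of_ridge (K : Set E) [CompactSpace K] (A : E →L[ℝ] ℝ) {l : ℕ}
    (hl : 2 ≤ l) {u : ℝ → ℂ} (hu : ContDiff ℝ l u) (hu2 : ContDiff ℝ 2 u)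
    (hi : Integrable (iteratedDeriv l u)) (L : C(K, JetSpace E) →L[ℂ] ℂ)
    (hL : ∀ b, L (jetCurve K A u hu2 b) = 0) {s : ℝ} (hs : 𝓕 (iteratedDeriv l u) s ≠ 0) :
    L (jetCurve K A (waveFun s) (contDiff_waveFun s) 0) = 0 := by
  obtain ⟨φ, hφ, hc, hφs⟩ := exists_contDiff_hasCompactSupport_fourier_ne_zero s
  have hφ2 : ContDiff ℝ 2 φ := by exact_mod_cast contDiff_infty.mp hφ 2
  -- After the derivatives are moved onto `φ`, the convolution is an integral of the values `L
  -- (jetCurve K A u hu2 _)`, all zero.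
  have hconv : convolution (iteratedDeriv l u) (fun b => L (jetCurve K A φ hφ2 b))
      (ContinuousLinearMap.mul ℂ ℂ) volume = 0 := by
    funext b
    have i1 := integrable_iteratedDeriv_smul_jetCurve_shift K A hu hφ2 hc b
    have i2 := integrable_iteratedDeriv_smul_jetCurve K A hu2 (contDiff_infty.mp hφ l) hc b
    have e1 := L.integral_comp_comm i1
    rw [integral_smul_jetCurve_eq K A hl hu hu2 hφ hφ2 hc b, ← L.integral_comp_comm i2] at e1
    simp only [map_smul, hL, smul_zero, integral_zero] at e1
    exact e1
  have h := Real.fourier_mul_convolution_eq hi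
    (L.integrable_comp (integrable_jetCurve K A hφ2 hc)) s
  rw [hconv, fourier_functional_jetCurve K A hφ2 hc L s] at h
  have h0 : 𝓕 (0 : ℝ → ℂ) s = 0 := by simp [Real.fourier_eq]
  rw [h0] at h
  simpa [hs, hφs] using h.symm

end Ridge

/-! ### Density of ridge functions in `C²(K)`. -/

section Density

set_option maxSynthPendingDepth 3

open scoped FourierTransform ContDiff

lemma exists_ne_zero_fourier_ne_zero {g : ℝ → ℂ} (hg : Continuous g) (hi : Integrable g)
    (h0 : g ≠ 0) : ∃ s : ℝ, s ≠ 0 ∧ 𝓕 g s ≠ 0 := by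
  by_contra! h
  have hc : Continuous (𝓕 g) :=
    VectorFourier.fourierIntegral_continuous Real.continuous_fourierChar
      (by exact continuous_inner) hi
  refine h0 (eq_zero_of_fourier_eq_zero hg hi ?_)
  -- Continuity of `𝓕 g` extends vanishing off `0` to vanishing everywhere.
  exact hc.ext_on (dense_compl_singleton 0) continuous_zero fun s hs => h s hs

/-- A point annihilated by every functional vanishing on `S` lies in the closure of `S`. -/
lemma Submodule.mem_closure_of_forall_dual {V : Type*} [NormedAddCommGroup V] [NormedSpace ℂ V]
    (S : Submodule ℂ V) (x : V)
    (h : ∀ L : V →L[ℂ] ℂ, (∀ a ∈ S, L a = 0) → L x = 0) : x ∈ closure (S : Set V) := by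
  by_contra hx
  have hconv : Convex ℝ (closure (S : Set V)) := (S.restrictScalars ℝ).convex.closure
  obtain ⟨L, r, hL, hr⟩ := RCLike.geometric_hahn_banach_closed_point (𝕜 := ℂ) hconv isClosed_closure hx
  have hzero : ∀ a ∈ S, L a = 0 := by
    intro a ha
    by_contra hne
    -- A functional bounded above on a subspace vanishes there: this multiple of `a` would take the
    -- value `r + 1`.
    have h1 := hL (((r + 1 : ℝ) / L a : ℂ) • a) (subset_closure (S.smul_mem _ ha))
    rw [map_smul, smul_eq_mul, div_mul_cancel₀ _ hne] at h1
    simp at h1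
    linarith
  have h0 := hL 0 (subset_closure S.zero_mem)
  rw [h L hzero] at hr
  simp only [map_zero] at h0 hr
  linarith

variable {E : Type*} [NormedAddCommGroup E] [InnerProductSpace ℝ E]

lemma jetCurve_innerSL_waveFun (K : Set E) [CompactSpace K] (w : E) (s : ℝ) :
    jetCurve K (innerSL ℝ w) (waveFun s) (contDiff_waveFun s) 0 =
      jetCurve K (.id ℝ E) (waveFun (s • w)) (contDiff_waveFun (s • w)) 0 := by
  ext1 x
  rw [jetCurve_apply, jetCurve_apply, ← twoJet_comp_affine _ _ (contDiff_waveFun s),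
    ← twoJet_comp_affine _ _ (contDiff_waveFun (s • w))]
  congr 1
  funext y
  simp [waveFun, inner_smul_right, real_inner_comm]

lemma jetCurve_id_apply (K : Set E) [CompactSpace K] {f : E → ℂ} (hf : ContDiff ℝ 2 f) (x : K) :
    jetCurve K (.id ℝ E) f hf 0 x = twoJet f x := by
  rw [jetCurve_apply, ← twoJet_comp_affine _ _ hf]
  simp

/-- Linear combinations of ridge functions `u (⟨w, x⟩ + b)` are dense in `C²` on compact sets. -/
theorem jetCurve_mem_closure_span_ridge [FiniteDimensional ℝ E] (K : Set E) [CompactSpace K]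
    {l : ℕ} (hl : 2 ≤ l) {u : ℝ → ℂ} (hu : ContDiff ℝ l u) (hu2 : ContDiff ℝ 2 u)
    (hi : Integrable (iteratedDeriv l u)) (h0 : iteratedDeriv l u ≠ 0)
    {f : E → ℂ} (hf : ContDiff ℝ 2 f) :
    jetCurve K (.id ℝ E) f hf 0 ∈ closure ((Submodule.span ℂ
      (Set.range fun z : E × ℝ => jetCurve K (innerSL ℝ z.1) u hu2 z.2) :
        Submodule ℂ C(K, JetSpace E)) : Set C(K, JetSpace E)) := by
  borelize E
  refine Submodule.mem_closure_of_forall_dual _ _ fun L hL => ?_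
  obtain ⟨s, hs0, hs⟩ := exists_ne_zero_fourier_ne_zero
    (hu.continuous_iteratedDeriv l le_rfl) hi h0
  have hwave : ∀ w : E, L (jetCurve K (.id ℝ E) (waveFun w) (contDiff_waveFun w) 0) = 0 := by
    intro w
    -- One good frequency `s ≠ 0` suffices, since direction `s⁻¹ • w` at frequency `s` is the wave
    -- of frequency vector `w`.
    have h1 := functional_wave_eq_zero_of_ridge K (innerSL ℝ (s⁻¹ • w)) hl hu hu2 hi L
      (fun b => hL _ (Submodule.subset_span ⟨(s⁻¹ • w, b), rfl⟩)) hs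
    rw [jetCurve_innerSL_waveFun] at h1
    simpa only [smul_inv_smul₀ hs0] using h1
  have hK : IsCompact K := isCompact_iff_compactSpace.mpr inferInstance
  obtain ⟨R, hR⟩ := hK.isBounded.subset_ball (0 : E)
  -- The cutoff is `1` on an open ball containing `K`, so multiplying by it leaves the two-jets on
  -- `K` unchanged.
  let ψ : ContDiffBump (0 : E) := ⟨max R 1, max R 1 + 1, by positivity, by linarith⟩
  have hg : ContDiff ℝ 2 (fun x => (ψ x : ℂ) * f x) :=
    (Complex.ofRealCLM.contDiff.comp ψ.contDiff).mul hf
  have hgc : HasCompactSupport (fun x => (ψ x : ℂ) * f x) :=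
    (ψ.hasCompactSupport.comp_left (g := fun r : ℝ => (r : ℂ)) Complex.ofReal_zero).mul_right
  have heq : jetCurve K (.id ℝ E) f hf 0 = jetCurve K (.id ℝ E) _ hg 0 := by
    ext1 x
    rw [jetCurve_id_apply, jetCurve_id_apply]
    refine twoJet_congr ?_
    have hx : (x : E) ∈ Metric.ball (0 : E) (max R 1) :=
      Metric.ball_subset_ball (le_max_left _ _) (hR x.2)
    filter_upwards [Metric.isOpen_ball.mem_nhds hx] with y hy
    rw [ψ.one_of_mem_closedBall (Metric.ball_subset_closedBall hy)]
    simp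
  rw [heq]
  exact functional_eq_zero_of_waves L hwave hg hgc 0

lemma twoJet_sub {f g : E → ℂ} (hf : ContDiff ℝ 2 f) (hg : ContDiff ℝ 2 g) (x : E) :
    twoJet (fun y => f y - g y) x = twoJet f x - twoJet g x := by
  have hf1 : ContDiff ℝ 1 (fderiv ℝ f) := hf.fderiv_right (by norm_num)
  have hg1 : ContDiff ℝ 1 (fderiv ℝ g) := hg.fderiv_right (by norm_num)
  have h1 : fderiv ℝ (fun y => f y - g y) = fun y => fderiv ℝ f y - fderiv ℝ g y := by
    funext y
    exact fderiv_fun_sub (hf.differentiable two_ne_zero y) (hg.differentiable two_ne_zero y)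
  refine Prod.ext rfl (Prod.ext (congrFun h1 x) ?_)
  change fderiv ℝ (fderiv ℝ _) x = _
  rw [h1]
  exact fderiv_fun_sub (hf1.differentiable one_ne_zero x) (hg1.differentiable one_ne_zero x)

lemma twoJet_sum {ι : Type*} (s : Finset ι) (c : ι → ℂ) {f : ι → E → ℂ}
    (hf : ∀ i, ContDiff ℝ 2 (f i)) (x : E) :
    twoJet (fun y => ∑ i ∈ s, c i • f i y) x = ∑ i ∈ s, c i • twoJet (f i) x := by
  have hf1 : ∀ i, ContDiff ℝ 1 (fderiv ℝ (f i)) := fun i => (hf i).fderiv_right (by norm_num)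
  have h1 : fderiv ℝ (fun y => ∑ i ∈ s, c i • f i y) =
      fun y => ∑ i ∈ s, c i • fderiv ℝ (f i) y := by
    funext y
    exact (HasFDerivAt.fun_sum fun i _ =>
      (((hf i).differentiable two_ne_zero y).hasFDerivAt.const_smul (c i))).fderiv
  have h2 : fderiv ℝ (fun y => ∑ i ∈ s, c i • fderiv ℝ (f i) y) x =
      ∑ i ∈ s, c i • fderiv ℝ (fderiv ℝ (f i)) x :=
    (HasFDerivAt.fun_sum fun i _ =>
      (((hf1 i).differentiable one_ne_zero x).hasFDerivAt.const_smul (c i))).fderiv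
  refine Prod.ext ?_ (Prod.ext ?_ ?_)
  · simp [twoJet, Prod.fst_sum]
  · simp only [twoJet, h1, Prod.fst_sum, Prod.snd_sum, Prod.smul_fst, Prod.smul_snd]
  · simp only [twoJet, h1, h2, Prod.snd_sum, Prod.smul_snd]

/-- Taking real parts does not increase the norm of two-jets. -/
lemma norm_re_jet_le {Q : E → ℂ} (hQ : ContDiff ℝ 2 Q) (x : E) :
    ‖(Q x).re‖ ≤ ‖twoJet Q x‖ ∧ ‖fderiv ℝ (fun y => (Q y).re) x‖ ≤ ‖twoJet Q x‖ ∧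
      ‖fderiv ℝ (fderiv ℝ (fun y => (Q y).re)) x‖ ≤ ‖twoJet Q x‖ := by
  have hQ1 : ContDiff ℝ 1 (fderiv ℝ Q) := hQ.fderiv_right (by norm_num)
  have h1 : fderiv ℝ (fun y => (Q y).re) =
      fun y => ContinuousLinearMap.compL ℝ E ℂ ℝ Complex.reCLM (fderiv ℝ Q y) := by
    funext y
    exact (Complex.reCLM.hasFDerivAt.comp y (hQ.differentiable two_ne_zero y).hasFDerivAt).fderiv
  have h2 : fderiv ℝ (fun y => ContinuousLinearMap.compL ℝ E ℂ ℝ Complex.reCLM (fderiv ℝ Q y)) x =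
      (ContinuousLinearMap.compL ℝ E ℂ ℝ Complex.reCLM).comp (fderiv ℝ (fderiv ℝ Q) x) :=
    ((ContinuousLinearMap.compL ℝ E ℂ ℝ Complex.reCLM).hasFDerivAt.comp x
      (hQ1.differentiable one_ne_zero x).hasFDerivAt).fderiv
  have hre : ∀ T : E →L[ℝ] ℂ, ‖ContinuousLinearMap.compL ℝ E ℂ ℝ Complex.reCLM T‖ ≤ ‖T‖ := by
    intro T
    refine (ContinuousLinearMap.opNorm_comp_le _ _).trans ?_
    rw [Complex.reCLM_norm, one_mul]
  refine ⟨(Complex.abs_re_le_norm _).trans (norm_fst_le (twoJet Q x)), ?_, ?_⟩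
  · rw [h1]
    exact (hre _).trans ((norm_fst_le _).trans (norm_snd_le (twoJet Q x)))
  · rw [h1, h2]
    refine le_trans ?_ ((norm_snd_le _).trans (norm_snd_le (twoJet Q x)))
    refine ContinuousLinearMap.opNorm_le_bound _ (norm_nonneg _) fun v => ?_
    exact (hre _).trans (ContinuousLinearMap.le_opNorm _ _)

end Density

/-! ### Approximation by networks, scalar and vector-valued. -/

section Networks

set_option maxSynthPendingDepth 3

variable {n : ℕ}

local notation "𝔼" => EuclideanSpace ℝ (Fin n)

lemma iteratedDeriv_ofReal {l : ℕ} {G : ℝ → ℝ} (hG : ContDiff ℝ l G) :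
    ∀ k ≤ l, iteratedDeriv k (fun t => (G t : ℂ)) = fun t => ((iteratedDeriv k G t : ℝ) : ℂ) := by
  intro k
  induction k with
  | zero => intro _; simp
  | succ k ih =>
    intro hk
    rw [iteratedDeriv_succ, ih (by omega)]
    funext t
    rw [iteratedDeriv_succ]
    exact (hG.differentiable_iteratedDeriv k (by exact_mod_cast hk) t).hasDerivAt.ofReal_comp.deriv

/-- Networks approximate `C²` functions together with their first two derivatives, uniformly on
compact sets. -/
theorem exists_isNeuralNetwork_fderiv_approx {K : Set 𝔼} (hK : IsCompact K) {G : ℝ → ℝ} {l : ℕ}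
    (hl : 2 ≤ l) (hG : LFinite l G) {H : 𝔼 → ℝ} (hH : ContDiff ℝ 2 H) {δ : ℝ} (hδ : 0 < δ) :
    ∃ H' : 𝔼 → ℝ, IsNeuralNetwork G H' ∧ ContDiff ℝ 2 H' ∧ ∀ x ∈ K, ‖H' x - H x‖ ≤ δ ∧
      ‖fderiv ℝ H' x - fderiv ℝ H x‖ ≤ δ ∧
      ‖fderiv ℝ (fderiv ℝ H') x - fderiv ℝ (fderiv ℝ H) x‖ ≤ δ := by
  have : CompactSpace K := isCompact_iff_compactSpace.mp hK
  obtain ⟨hGl, hpos, hfin⟩ := hG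
  have hG2 : ContDiff ℝ 2 G := hGl.of_le (by exact_mod_cast hl)
  have hu : ContDiff ℝ l (fun t => (G t : ℂ)) := Complex.ofRealCLM.contDiff.comp hGl
  have hu2 : ContDiff ℝ 2 (fun t => (G t : ℂ)) := Complex.ofRealCLM.contDiff.comp hG2
  have hul := iteratedDeriv_ofReal hGl l le_rfl
  have hint : Integrable (iteratedDeriv l G) :=
    ⟨(hGl.continuous_iteratedDeriv l le_rfl).aestronglyMeasurable, hfin⟩
  have hne : iteratedDeriv l (fun t => (G t : ℂ)) ≠ 0 := by
    intro h
    rw [hul] at h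
    refine hpos.ne' ?_
    have : ∀ t, iteratedDeriv l G t = 0 := fun t => by simpa using congrFun h t
    simp [this]
  have hHc : ContDiff ℝ 2 (fun x => (H x : ℂ)) := Complex.ofRealCLM.contDiff.comp hH
  have hmem := jetCurve_mem_closure_span_ridge K hl hu hu2 (hul ▸ hint.ofReal) hne hHc
  obtain ⟨F, hF, hdist⟩ := (Metric.mem_closure_iff (α := C(K, JetSpace 𝔼))).mp hmem δ hδ
  obtain ⟨N, c, z, rfl⟩ := Submodule.mem_span_set'.mp hF
  choose p hp using fun j => (z j).2
  have hridge : ∀ j, ContDiff ℝ 2 (fun x : 𝔼 => ((G (inner ℝ (p j).1 x + (p j).2) : ℝ) : ℂ)) :=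
    fun j => hu2.comp ((contDiff_const.inner ℝ contDiff_id).add contDiff_const)
  let Q₀ : 𝔼 → ℂ := fun x => ∑ j, c j • ((G (inner ℝ (p j).1 x + (p j).2) : ℝ) : ℂ)
  have hQ₀ : ContDiff ℝ 2 Q₀ := ContDiff.sum fun j _ => (hridge j).const_smul (c j)
  let H' : 𝔼 → ℝ := fun x => (Q₀ x).re
  have hH' : ContDiff ℝ 2 H' := Complex.reCLM.contDiff.comp hQ₀
  -- `G` is real, so the real part of the complex combination is the network with coefficients `(c
  -- j).re`.
  refine ⟨H', ⟨N, fun j => (p j).1, fun j => (p j).2, fun j => (c j).re, fun x => ?_⟩, hH',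
    fun x hx => ?_⟩
  · simp [H', Q₀, mul_comm]
  have hQ : ContDiff ℝ 2 (fun y => Q₀ y - (H y : ℂ)) := hQ₀.sub hHc
  have hjet : ‖twoJet (fun y => Q₀ y - (H y : ℂ)) x‖ ≤ δ := by
    rw [twoJet_sub hQ₀ hHc, twoJet_sum _ _ hridge, ← norm_neg, neg_sub]
    rw [dist_eq_norm] at hdist
    refine le_trans (le_of_eq ?_) ((ContinuousMap.norm_coe_le_norm _ (⟨x, hx⟩ : K)).trans hdist.le)
    congr 1
    rw [ContinuousMap.sub_apply, jetCurve_id_apply, ContinuousMap.sum_apply]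
    congr 1
    refine Finset.sum_congr rfl fun j _ => ?_
    rw [ContinuousMap.smul_apply, ← hp j, jetCurve_apply, ← twoJet_comp_affine _ _ hu2]
    rfl
  obtain ⟨b0, b1, b2⟩ := norm_re_jet_le hQ x
  have hre : (fun y => (Q₀ y - (H y : ℂ)).re) = fun y => H' y - H y := by
    funext y; simp [H']
  have hd : fderiv ℝ (fun y => H' y - H y) = fun y => fderiv ℝ H' y - fderiv ℝ H y := by
    funext y
    exact fderiv_fun_sub (hH'.differentiable two_ne_zero y) (hH.differentiable two_ne_zero y)
  have hH1 : ContDiff ℝ 1 (fderiv ℝ H) := hH.fderiv_right (by norm_num)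
  have hH1' : ContDiff ℝ 1 (fderiv ℝ H') := hH'.fderiv_right (by norm_num)
  rw [hre, hd] at b1 b2
  rw [fderiv_fun_sub (hH1'.differentiable one_ne_zero x) (hH1.differentiable one_ne_zero x)] at b2
  refine ⟨?_, b1.trans hjet, b2.trans hjet⟩
  have := b0.trans hjet
  rwa [show (Q₀ x - (H x : ℂ)).re = H' x - H x from congrFun hre x] at this

variable {V : Type*} {G : ℝ → ℝ}

lemma IsNeuralNetwork.zero [AddCommGroup V] [Module ℝ V] :
    IsNeuralNetwork G (fun _ : 𝔼 => (0 : V)) :=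
  ⟨0, Fin.elim0, Fin.elim0, Fin.elim0, fun x => by simp⟩

lemma IsNeuralNetwork.add [AddCommGroup V] [Module ℝ V] {f g : 𝔼 → V}
    (hf : IsNeuralNetwork G f) (hg : IsNeuralNetwork G g) :
    IsNeuralNetwork G (fun x => f x + g x) := by
  obtain ⟨N, w, b, c, h⟩ := hf
  obtain ⟨N', w', b', c', h'⟩ := hg
  refine ⟨N + N', Fin.append w w', Fin.append b b', Fin.append c c', fun x => ?_⟩
  simp [h, h', Fin.sum_univ_add]

lemma IsNeuralNetwork.sum [AddCommGroup V] [Module ℝ V] {ι : Type*} (s : Finset ι)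
    {f : ι → 𝔼 → V} (hf : ∀ i, IsNeuralNetwork G (f i)) :
    IsNeuralNetwork G (fun x => ∑ i ∈ s, f i x) := by
  classical
  induction s using Finset.induction_on with
  | empty => simpa using IsNeuralNetwork.zero
  | insert i s hi ih => simpa [Finset.sum_insert hi] using (hf i).add ih

lemma IsNeuralNetwork.smul_const [AddCommGroup V] [Module ℝ V] {f : 𝔼 → ℝ}
    (hf : IsNeuralNetwork G f) (v : V) : IsNeuralNetwork G (fun x => f x • v) := by
  obtain ⟨N, w, b, c, h⟩ := hf
  exact ⟨N, w, b, fun j => c j • v, fun x => by simp [h, Finset.sum_smul, smul_smul]⟩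

/-- Scalar networks approximate continuous functions uniformly on compact sets. -/
lemma exists_isNeuralNetwork_approx_real {K : Set 𝔼} (hK : IsCompact K) {l : ℕ} (hl : 2 ≤ l)
    (hG : LFinite l G) {f : 𝔼 → ℝ} (hf : ContinuousOn f K) {δ : ℝ} (hδ : 0 < δ) :
    ∃ f' : 𝔼 → ℝ, IsNeuralNetwork G f' ∧ ∀ x ∈ K, ‖f' x - f x‖ ≤ δ := by
  -- Tietze extends `f` from `K` to a continuous `g`, which is then smoothed within `δ / 2`.
  obtain ⟨g, hg⟩ := ContinuousMap.exists_restrict_eq hK.isClosed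
    (⟨K.domRestrict f, hf.domRestrict⟩ : C(K, ℝ))
  obtain ⟨h, hh, hgh, -⟩ := g.continuous.exists_contDiff_approx 2 (ε := fun _ => δ / 2)
    continuous_const fun _ => half_pos hδ
  obtain ⟨f', hf', -, hf'h⟩ := exists_isNeuralNetwork_fderiv_approx hK hl hG
    (H := h) (by exact_mod_cast hh) (half_pos hδ)
  refine ⟨f', hf', fun x hx => ?_⟩
  have e : g x = f x := DFunLike.congr_fun hg (⟨x, hx⟩ : K)
  have h1 := (hf'h x hx).1
  have h2 := hgh x
  rw [dist_eq_norm, e] at h2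
  calc ‖f' x - f x‖ = ‖(f' x - h x) + (h x - f x)‖ := by congr 1; ring
    _ ≤ ‖f' x - h x‖ + ‖h x - f x‖ := norm_add_le _ _
    _ ≤ δ := by linarith

/-- Networks with values in a finite-dimensional space approximate continuous functions uniformly
on compact sets. -/
theorem exists_isNeuralNetwork_approx [NormedAddCommGroup V] [NormedSpace ℝ V]
    [FiniteDimensional ℝ V] {K : Set 𝔼} (hK : IsCompact K) {l : ℕ} (hl : 2 ≤ l)
    (hG : LFinite l G) {f : 𝔼 → V} (hf : ContinuousOn f K) {δ : ℝ} (hδ : 0 < δ) :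
    ∃ f' : 𝔼 → V, IsNeuralNetwork G f' ∧ ∀ x ∈ K, ‖f' x - f x‖ ≤ δ := by
  let e := Module.finBasis ℝ V
  let C : ℝ := ∑ i, ‖e i‖
  have hC : 0 ≤ C := Finset.sum_nonneg fun i _ => norm_nonneg _
  have hcoord : ∀ i, ContinuousOn (fun x => e.coord i (f x)) K := fun i =>
    (LinearMap.continuous_of_finiteDimensional (e.coord i)).comp_continuousOn hf
  -- The `+ 1` keeps the denominator positive even when `V` is trivial.
  choose g hg hgf using fun i => exists_isNeuralNetwork_approx_real hK hl hG (hcoord i)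
    (div_pos hδ (by positivity : (0 : ℝ) < C + 1))
  refine ⟨fun x => ∑ i, g i x • e i, .sum _ fun i => (hg i).smul_const _, fun x hx => ?_⟩
  have hfx : f x = ∑ i, e.coord i (f x) • e i := (e.sum_repr (f x)).symm
  rw [hfx, ← Finset.sum_sub_distrib]
  simp_rw [← sub_smul]
  calc ‖∑ i, (g i x - e.coord i (f x)) • e i‖
      ≤ ∑ i, δ / (C + 1) * ‖e i‖ := norm_sum_le_of_le _ fun i _ => by
        rw [norm_smul]
        exact mul_le_mul_of_nonneg_right (hgf i x hx) (norm_nonneg _)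
    _ = δ * (C / (C + 1)) := by rw [← Finset.mul_sum]; ring
    _ ≤ δ := mul_le_of_le_one_right hδ.le ((div_le_one (by positivity)).mpr (by linarith))

/-- The Riesz isomorphism as a continuous real-linear map. -/
noncomputable def rieszCLM (n : ℕ) :
    (EuclideanSpace ℝ (Fin n) →L[ℝ] ℝ) →L[ℝ] EuclideanSpace ℝ (Fin n) :=
  LinearMap.toContinuousLinearMap
    { toFun := (InnerProductSpace.toDual ℝ (EuclideanSpace ℝ (Fin n))).symm
      map_add' := map_add _
      map_smul' := fun c x => by simp }

lemma norm_rieszCLM (T : 𝔼 →L[ℝ] ℝ) : ‖rieszCLM n T‖ = ‖T‖ :=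
  (InnerProductSpace.toDual ℝ 𝔼).symm.norm_map T

lemma gradient_eq_rieszCLM (f : 𝔼 → ℝ) (x : 𝔼) : ∇ f x = rieszCLM n (fderiv ℝ f x) := rfl

lemma hessian_eq_rieszCLM_comp {f : 𝔼 → ℝ} (hf : ContDiff ℝ 2 f) (x : 𝔼) :
    hessian f x = (rieszCLM n).comp (fderiv ℝ (fderiv ℝ f) x) := by
  have hf1 : ContDiff ℝ 1 (fderiv ℝ f) := hf.fderiv_right (by norm_num)
  exact ((rieszCLM n).hasFDerivAt.comp x
    (hf1.differentiable one_ne_zero x).hasFDerivAt).fderiv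

lemma enorm_le_ofReal {W : Type*} [SeminormedAddCommGroup W] {a : W} {δ : ℝ} (h : ‖a‖ ≤ δ) :
    ‖a‖ₑ ≤ ENNReal.ofReal δ := by
  rw [← ofReal_norm]
  exact ENNReal.ofReal_le_ofReal h

lemma exists_isNeuralNetwork_c2Dist_le {K : Set 𝔼} (hK : IsCompact K) {l : ℕ} (hl : 2 ≤ l)
    (hG : LFinite l G) {H : 𝔼 → ℝ} (hH : ContDiff ℝ 2 H) {δ : ℝ} (hδ : 0 < δ) :
    ∃ H' : 𝔼 → ℝ, IsNeuralNetwork G H' ∧ c2Dist K H' H ≤ ENNReal.ofReal δ := by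
  obtain ⟨H', hN, hH', h⟩ := exists_isNeuralNetwork_fderiv_approx hK hl hG hH
    (div_pos hδ three_pos)
  refine ⟨H', hN, ?_⟩
  have hsum : ENNReal.ofReal δ = ENNReal.ofReal (δ / 3) + ENNReal.ofReal (δ / 3) +
      ENNReal.ofReal (δ / 3) := by
    rw [← ENNReal.ofReal_add (by positivity) (by positivity),
      ← ENNReal.ofReal_add (by positivity) (by positivity)]
    congr 1
    ring
  rw [hsum, c2Dist]
  refine add_le_add (add_le_add ?_ ?_) ?_
  · exact iSup₂_le fun x hx => enorm_le_ofReal (h x hx).1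
  · refine iSup₂_le fun x hx => enorm_le_ofReal ?_
    rw [gradient_eq_rieszCLM, gradient_eq_rieszCLM, ← map_sub, norm_rieszCLM]
    exact (h x hx).2.1
  · refine iSup₂_le fun x hx => enorm_le_ofReal ?_
    rw [hessian_eq_rieszCLM_comp hH', hessian_eq_rieszCLM_comp hH, ← ContinuousLinearMap.comp_sub]
    refine ContinuousLinearMap.opNorm_le_bound _ (by positivity) fun v => ?_
    rw [ContinuousLinearMap.comp_apply, norm_rieszCLM]
    exact ContinuousLinearMap.le_of_opNorm_le _ (h x hx).2.2 v

end Networks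

/-! ### Operator-norm estimates for transposes and Gram matrices. -/

section Matrices

lemma Matrix.l2_opNorm_transpose_real {m k : ℕ} (M : Matrix (Fin m) (Fin k) ℝ) : ‖Mᵀ‖ = ‖M‖ := by
  rw [← Matrix.conjTranspose_eq_transpose_of_trivial, Matrix.l2_opNorm_conjTranspose]

/-- Expand around `N`: with `E = M - N` the difference is `EᵀE + EᵀN + NᵀE`. -/
lemma Matrix.l2_opNorm_gram_sub_le {m k : ℕ} (M N : Matrix (Fin m) (Fin k) ℝ) :
    ‖Mᵀ * M - Nᵀ * N‖ ≤ ‖M - N‖ * (‖M - N‖ + 2 * ‖N‖) := by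
  have h : Mᵀ * M - Nᵀ * N = (M - N)ᵀ * (M - N) + ((M - N)ᵀ * N + Nᵀ * (M - N)) := by
    simp only [Matrix.transpose_sub, Matrix.sub_mul, Matrix.mul_sub]
    abel
  rw [h]
  refine (norm_add_le _ _).trans ?_
  have h1 := Matrix.l2_opNorm_mul (M - N)ᵀ (M - N)
  have h2 := Matrix.l2_opNorm_mul (M - N)ᵀ N
  have h3 := Matrix.l2_opNorm_mul Nᵀ (M - N)
  rw [Matrix.l2_opNorm_transpose_real] at h1 h2 h3
  have h4 := norm_add_le ((M - N)ᵀ * N) (Nᵀ * (M - N))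
  linarith

end Matrices

/-! ### Structure-preserving approximation. -/

theorem mainTheorem6 {n d r : ℕ} (K : Set (EuclideanSpace ℝ (Fin n))) (hK : IsCompact K)
    (J : EuclideanSpace ℝ (Fin n) → Matrix (Fin n) (Fin n) ℝ) (hJ : ContinuousOn J K)
    (hJskew : ∀ x ∈ K, J x = -(J x)ᵀ)
    (σ : EuclideanSpace ℝ (Fin n) → Matrix (Fin n) (Fin d) ℝ) (hσ : ContinuousOn σ K)
    (H : EuclideanSpace ℝ (Fin n) → ℝ) (hH : ContDiff ℝ 2 H)
    (D : EuclideanSpace ℝ (Fin n) → Matrix (Fin r) (Fin n) ℝ) (hD : ContinuousOn D K)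
    (R : EuclideanSpace ℝ (Fin n) → Matrix (Fin n) (Fin n) ℝ)
    (hR : ∀ x ∈ K, R x = (D x)ᵀ * D x)
    (G : ℝ → ℝ) (l : ℕ) (hl : 2 < l) (hG : LFinite l G)
    (ε : ℝ) (hε : 0 < ε) :
    ∃ (A' : EuclideanSpace ℝ (Fin n) → Matrix (Fin n) (Fin n) ℝ)
      (D' : EuclideanSpace ℝ (Fin n) → Matrix (Fin r) (Fin n) ℝ)
      (σ' : EuclideanSpace ℝ (Fin n) → Matrix (Fin n) (Fin d) ℝ)
      (H' : EuclideanSpace ℝ (Fin n) → ℝ),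
      IsNeuralNetwork G A' ∧ IsNeuralNetwork G D' ∧ IsNeuralNetwork G σ' ∧ IsNeuralNetwork G H' ∧
      (∀ x, A' x - (A' x)ᵀ = -(A' x - (A' x)ᵀ)ᵀ ∧ ((D' x)ᵀ * D' x).PosSemidef) ∧
      (⨆ x ∈ K, (‖(A' x - (A' x)ᵀ) - J x‖ₑ + ‖(D' x)ᵀ * D' x - R x‖ₑ + ‖σ' x - σ x‖ₑ))
        + c2Dist K H' H ≤ ENNReal.ofReal ε := by
  have hl2 : 2 ≤ l := hl.le
  -- Half of `ε` goes to the `C²` distance; the three matrix errors share the other half.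
  have hδ : 0 < ε / 6 := by positivity
  obtain ⟨B, hB⟩ : ∃ B, ∀ x ∈ K, ‖D x‖ ≤ B := hK.exists_bound_of_continuousOn hD
  have hB' : ∀ x ∈ K, ‖D x‖ ≤ max B 0 := fun x hx => (hB x hx).trans (le_max_left _ _)
  set C := max B 0
  have hC : 0 ≤ C := le_max_right _ _
  -- In the Gram bound `η (η + 2 * C)`, `η ≤ 1` controls the second factor and the other entry then
  -- gives `ε / 6`.
  let η : ℝ := min 1 (ε / 6 / (1 + 2 * C))
  have hη : 0 < η := lt_min one_pos (by positivity)
  -- Skew-symmetry gives `J = J / 2 - (J / 2)ᵀ`, so skew-symmetrizing an approximation of `J / 2` at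
  -- most doubles the error `ε / 12`.
  obtain ⟨A', hA', hA⟩ := exists_isNeuralNetwork_approx hK hl2 hG
    (f := fun x => (2⁻¹ : ℝ) • J x) (hJ.const_smul (2⁻¹ : ℝ)) (half_pos hδ)
  obtain ⟨D', hD', hDa⟩ := exists_isNeuralNetwork_approx hK hl2 hG hD hη
  obtain ⟨σ', hσ', hσa⟩ := exists_isNeuralNetwork_approx hK hl2 hG hσ hδ
  obtain ⟨H', hH', hHa⟩ := exists_isNeuralNetwork_c2Dist_le hK hl2 hG hH (half_pos hε)
  refine ⟨A', D', σ', H', hA', hD', hσ', hH', fun x => ⟨?_, ?_⟩, ?_⟩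
  · simp [Matrix.transpose_sub]
  · rw [← Matrix.conjTranspose_eq_transpose_of_trivial]
    exact Matrix.posSemidef_conjTranspose_mul_self _
  have hsplit : ENNReal.ofReal ε = ENNReal.ofReal (ε / 6) + ENNReal.ofReal (ε / 6) +
      ENNReal.ofReal (ε / 6) + ENNReal.ofReal (ε / 2) := by
    rw [← ENNReal.ofReal_add (by positivity) (by positivity),
      ← ENNReal.ofReal_add (by positivity) (by positivity),
      ← ENNReal.ofReal_add (by positivity) (by positivity)]
    congr 1
    ring
  rw [hsplit]
  refine add_le_add (iSup₂_le fun x hx => add_le_add (add_le_add ?_ ?_) ?_) hHa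
  · refine enorm_le_ofReal ?_
    have hskew : (A' x - (A' x)ᵀ) - J x =
        (A' x - (2⁻¹ : ℝ) • J x) - (A' x - (2⁻¹ : ℝ) • J x)ᵀ := by
      have h1 : (J x)ᵀ = -J x := by
        conv_rhs => rw [hJskew x hx, neg_neg]
      rw [Matrix.transpose_sub, Matrix.transpose_smul, h1]
      module
    rw [hskew]
    refine (norm_sub_le _ _).trans ?_
    rw [Matrix.l2_opNorm_transpose_real]
    have := hA x hx
    linarith
  · refine enorm_le_ofReal ?_
    rw [hR x hx]
    refine (Matrix.l2_opNorm_gram_sub_le _ _).trans ?_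
    have h1 := hDa x hx
    have h2 := hB' x hx
    calc ‖D' x - D x‖ * (‖D' x - D x‖ + 2 * ‖D x‖) ≤ ε / 6 / (1 + 2 * C) * (1 + 2 * C) := by
          refine mul_le_mul (h1.trans (min_le_right _ _)) ?_ (by positivity) (by positivity)
          have := h1.trans (min_le_left _ _)
          linarith
      _ = ε / 6 := div_mul_cancel₀ _ (by positivity)
  · exact enorm_le_ofReal (hσa x hx)
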